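/- Let $p$ be an odd prime, let $n,g\ge 1$ be integers, and let $A=(\mathbf Z/p^n\mathbf Z)^g$, with the characters $\chi_y(x)=e^{2\pi i\,x\cdot y/p^n}$ for $x,y\in A$. Let $K=A\times A$, and let $\mathrm{Aut}(K,e)$ be the group of automorphisms of the abelian group $K$ that preserve $e((x,y),(x',y'))=\chi_{y'}(x)\chi_y(x')^{-1}$ (a symplectic group). For $k=(x,y)\in K$ let $\mathcal W_k$ be the operator on $L^2(A)$ with $(\mathcal W_kf)(u)=\chi_y(u-x/2)f(u-x)$. A Weil representation of $\mathrm{Aut}(K,e)$ is a choice, for every $\sigma\in\mathrm{Aut}(K,e)$, of a unitary operator $W(\sigma)$ on $L^2(A)$ with $W(\sigma)\mathcal W_kW(\sigma)^{-1}=\mathcal W_{\sigma(k)}$ for all $k\in K$. For $0\le r\le\lfloor n/2\rfloor$ let $V_{n-2r}^{+}$ (resp. $V_{n-2r}^{-}$) be the space of even (resp. odd) functions on $A$ that are supported on $p^rA$ and invariant under translation by $p^{n-r}A$. For $r<\lfloor n/2\rfloor$ let $U_{n-2r}^\pm$ be the orthogonal complement of $V_{n-2r-2}^\pm$ in $V_{n-2r}^\pm$,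 and for $r=\lfloor n/2\rfloor$ let $U_{n-2r}^\pm=V_{n-2r}^\pm$. Theorem. A Weil representation exists. If $n$ is even, then $U_0^-=0$. The space $L^2(A)$ is the orthogonal direct sum $$L^2(A)=\bigoplus_{r=0}^{\lfloor n/2\rfloor}\left(U_{n-2r}^+\oplus U_{n-2r}^-\right)$$ (with $U_0^-$ omitted when $n$ is even). For every Weil representation, the summands are irreducible invariant subspaces, and every irreducible invariant subspace of $L^2(A)$ is one of them. Moreover $$\dim U_{n-2r}^\pm=\begin{cases}\left(p^{g(n-2r)}-p^{g(n-2r-2)}\right)/2 & \text{if } 0\le r<\lfloor n/2\rfloor,\\ \left(\pm1+p^{g(n-2r)}\right)/2 & \text{if } r=\lfloor n/2\rfloor.\end{cases}$$ -/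

import Mathlib

noncomputable section

namespace FiniteWeil

/-- The finite abelian group `A = (ℤ/N)^g`. -/
abbrev A (g N : ℕ) : Type := Fin g → ZMod N

/-- `K = A × A`, where the second factor is identified with the Pontryagin dual of `A` through
`y ↦ χ_y`. -/
abbrev K (g N : ℕ) : Type := A g N × A g N

/-- The Hilbert space `L²(A)` of complex functions on `A` (counting measure). -/
abbrev L2 (g N : ℕ) : Type := EuclideanSpace ℂ (A g N)

/-- The character `χ_y(x) = exp (2 π i (y · x) / N)`. -/
def chi {g N : ℕ} [NeZero N] (y x : A g N) : ℂ :=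
  ZMod.stdAddChar (y ⬝ᵥ x)

/-- The translation operator `(T_x f)(u) = f (u - x)`. -/
def translation {g N : ℕ} (x : A g N) : L2 g N →ₗ[ℂ] L2 g N where
  toFun f := WithLp.toLp 2 fun u => f (u - x)
  map_add' _ _ := rfl
  map_smul' _ _ := rfl

/-- The modulation operator `(M_y f)(u) = χ_y(u) f(u)`. -/
def modulation {g N : ℕ} [NeZero N] (y : A g N) : L2 g N →ₗ[ℂ] L2 g N where
  toFun f := WithLp.toLp 2 fun u => chi y u * f u
  map_add' f h := by
    ext u
    simp [mul_add]
  map_smul' c f := by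
    ext u
    simp [mul_left_comm]

/-- The Weyl operator `W_(x,y) = T_x M_y`. -/
def weyl {g N : ℕ} [NeZero N] (k : K g N) : L2 g N →ₗ[ℂ] L2 g N :=
  translation k.1 ∘ₗ modulation k.2

/-- The normalised Weyl operator `χ_y(x/2) W_(x,y)`, meant for odd `N`, where `2` is a unit. -/
def normWeyl {g N : ℕ} [NeZero N] (k : K g N) : L2 g N →ₗ[ℂ] L2 g N :=
  chi k.2 ((2 : ZMod N)⁻¹ • k.1) • weyl k

/-- The alternating bicharacter `e((x,y),(x',y')) = χ_{y'}(x) χ_y(x')⁻¹` on `K`. -/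
def e {g N : ℕ} [NeZero N] (k l : K g N) : ℂ :=
  chi l.2 k.1 * (chi k.2 l.1)⁻¹

/-- `Aut(K, e)`: the automorphisms of the abelian group `K` that preserve `e`. They form a group
under composition. -/
abbrev autKe (g N : ℕ) [NeZero N] : Type :=
  {a : K g N ≃+ K g N // ∀ k l, e (a k) (a l) = e k l}

/-- `W` is a Weil representation of `Aut(K, e)` on `L²(A)`: a choice, for every `a ∈ Aut(K, e)`,
of a unitary operator `W a` with `(W a) 𝒲_k (W a)⁻¹ = 𝒲_{a k}` for all `k`, where `𝒲_k` are the
normalised Weyl operators. Such operators are determined by `a` up to unitary scalars. -/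
def IsWeilRep {g N : ℕ} [NeZero N] (W : autKe g N → (L2 g N ≃ₗᵢ[ℂ] L2 g N)) : Prop :=
  ∀ (a : autKe g N) (k : K g N) (f : L2 g N),
    W a (normWeyl k ((W a).symm f)) = normWeyl (a.1 k) f

/-- The subspace `X` is invariant under all the operators `W a`. -/
def IsInvariant {g N : ℕ} [NeZero N] (W : autKe g N → (L2 g N ≃ₗᵢ[ℂ] L2 g N))
    (X : Submodule ℂ (L2 g N)) : Prop :=
  ∀ a, ∀ f ∈ X, W a f ∈ X

/-- `X` is an irreducible invariant subspace: it is invariant and nonzero, and its only invariant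
subspaces are `0` and `X`. -/
def IsIrreducibleSubspace {g N : ℕ} [NeZero N] (W : autKe g N → (L2 g N ≃ₗᵢ[ℂ] L2 g N))
    (X : Submodule ℂ (L2 g N)) : Prop :=
  IsInvariant W X ∧ X ≠ ⊥ ∧
    ∀ Y : Submodule ℂ (L2 g N), Y ≤ X → IsInvariant W Y → Y = ⊥ ∨ Y = X

/-- The subgroup `p^r A` of `A`. -/
def powSubgroup (g N p r : ℕ) : AddSubgroup (A g N) :=
  (nsmulAddMonoidHom (α := A g N) (p ^ r)).range

/-- For `A = (ℤ/p^n)^g`, the space `V_{n-2r}^ε` of functions on `A` that are supported on `p^r A`,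
invariant under translation by `p^{n-r} A`, and even (`ε = 1`) or odd (`ε = -1`). -/
def V (g p n r : ℕ) (ε : ℤˣ) : Submodule ℂ (L2 g (p ^ n)) where
  carrier := {f | (∀ u, u ∉ powSubgroup g (p ^ n) p r → f u = 0) ∧
    (∀ t ∈ powSubgroup g (p ^ n) p (n - r), ∀ u, f (u + t) = f u) ∧
    ∀ u, f (-u) = ((ε : ℤ) : ℂ) * f u}
  add_mem' {f h} hf hh :=
    ⟨fun u hu => by simp [hf.1 u hu, hh.1 u hu],
      fun t ht u => by simp [hf.2.1 t ht u, hh.2.1 t ht u],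
      fun u => by simp [hf.2.2 u, hh.2.2 u, mul_add]⟩
  zero_mem' := ⟨fun _ _ => rfl, fun _ _ _ => rfl, fun u => by simp⟩
  smul_mem' c f hf :=
    ⟨fun u hu => by simp [hf.1 u hu],
      fun t ht u => by simp [hf.2.1 t ht u],
      fun u => by simp [hf.2.2 u, mul_left_comm]⟩

/-- `U_{n-2r}^ε`: the orthogonal complement of `V_{n-2r-2}^ε` in `V_{n-2r}^ε` for `r < ⌊n/2⌋`, and
`V_{n-2r}^ε` itself for `r = ⌊n/2⌋`. -/
def U (g p n : ℕ) [NeZero (p ^ n)] (r : ℕ) (ε : ℤˣ) : Submodule ℂ (L2 g (p ^ n)) :=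
  if r < n / 2 then V g p n r ε ⊓ (V g p n (r + 1) ε)ᗮ else V g p n r ε

/-- The pairs `(r, ε)` with `0 ≤ r ≤ ⌊n/2⌋` and `ε = ±1`, without `(n/2, -1)` when `n` is even. -/
abbrev Index (n : ℕ) : Type :=
  {i : Fin (n / 2 + 1) × ℤˣ // ¬ (Even n ∧ (i.1 : ℕ) = n / 2 ∧ i.2 = -1)}

end FiniteWeil

end

/-!
The normalised Weyl operators satisfy `𝒲_k 𝒲_l = ψ (-ω(k, l) / 2) 𝒲_{k+l}`, where `ω` is the
alternating form on `K` with `e = ψ ∘ ω` (`normWeyl_comp`). They are complete in `End L²(A)`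
(`eq_zero_of_trace_normWeyl_comp`), and only scalars commute with all of them
(`eq_smul_id_of_commute`). An automorphism `a` of `(K, e)` preserves the cocycle, so averaging a
rank-one operator over `K` gives a nonzero operator that intertwines `𝒲_k` and `𝒲_{a k}`, and
Schur's lemma makes it a multiple of a unitary one. This is the Weil representation
(`exists_isWeilRep`).

The space `V_{n-2r}^ε` consists of the vectors of parity `ε` fixed by the Weyl operators of the
isotropic subgroup `p^{n-r} K` (`mem_V_iff`). This subgroup is characteristic, and the parity
operator is proportional to `∑ k, 𝒲_k` (`sum_normWeyl`), so `V_{n-2r}^ε` is invariant under every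
Weil representation. Its dimension is the trace of the averaging projection
(`finrank_fixed_parity`). The spaces `U_{n-2r}^ε` are then invariant, pairwise orthogonal, nonzero
for the admissible indices, and span `L²(A)`.

Irreducibility comes from counting. An operator `T` in the commutant of a Weil representation is
determined by the function `k ↦ tr (𝒲_k T)`, which is constant on the orbits of `Aut(K, e)`.
Symplectic transvections act transitively on primitive vectors (`exists_autKe_of_primitive`), so
the orbits are represented by `p^j k₀` with `0 ≤ j ≤ n`, and the commutant has dimension at most
`n + 1` (`finrank_commutant_le`). This is the number of summands, so the projections onto them span
the commutant. The projection onto an invariant subspace is therefore a combination of these, and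
acts on each summand as a scalar: the subspace contains the summand or is orthogonal to it
(`le_or_le_orthogonal_of_isInvariant`).
-/

noncomputable section

namespace FiniteWeil

open Module

/-! ### The symplectic form -/

section Weyl

variable {g N : ℕ}

/-- The alternating form on `K` with values in `ℤ/N` of which `e` is the exponential. -/
def omega (k l : K g N) : ZMod N := l.2 ⬝ᵥ k.1 - k.2 ⬝ᵥ l.1

theorem omega_add_left (k k' l : K g N) : omega (k + k') l = omega k l + omega k' l := by
  simp [omega, dotProduct_add, add_dotProduct]; ring

theorem omega_add_right (k l l' : K g N) : omega k (l + l') = omega k l + omega k l' := by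
  simp [omega, dotProduct_add, add_dotProduct]; ring

theorem omega_smul_left (c : ZMod N) (k l : K g N) : omega (c • k) l = c * omega k l := by
  simp [omega, dotProduct_smul, smul_dotProduct]; ring

theorem omega_smul_right (c : ZMod N) (k l : K g N) : omega k (c • l) = c * omega k l := by
  simp [omega, dotProduct_smul, smul_dotProduct]; ring

theorem omega_neg_left (k l : K g N) : omega (-k) l = -omega k l := by
  simp [omega]; ring

theorem omega_neg_right (k l : K g N) : omega k (-l) = -omega k l := by
  simp [omega]; ring

theorem omega_self (k : K g N) : omega k k = 0 := by
  simp [omega]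

theorem omega_swap (k l : K g N) : omega k l = -omega l k := by
  simp [omega]

/-- The alternating form `omega` is nondegenerate, as witnessed by the standard basis. -/
theorem omega_eq_zero_of_forall {k : K g N} (h : ∀ l, omega l k = 0) : k = 0 := by
  ext i
  · have := h (0, Pi.single i 1)
    simpa [omega] using this
  · have := h (Pi.single i 1, 0)
    simpa [omega] using this

variable [NeZero N]

theorem e_eq_stdAddChar_omega (k l : K g N) : e k l = ZMod.stdAddChar (omega k l) := by
  rw [e, chi, chi, omega, AddChar.map_sub_eq_div, div_eq_mul_inv]

theorem autKe_omega (a : autKe g N) (k l : K g N) : omega (a.1 k) (a.1 l) = omega k l := by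
  have h := a.2 k l
  rw [e_eq_stdAddChar_omega, e_eq_stdAddChar_omega] at h
  exact ZMod.injective_stdAddChar h

theorem stdAddChar_eq_one_iff (x : ZMod N) : ZMod.stdAddChar x = (1 : ℂ) ↔ x = 0 := by
  rw [← AddChar.map_zero_eq_one (ZMod.stdAddChar (N := N))]
  exact ZMod.injective_stdAddChar.eq_iff

theorem sum_stdAddChar_dotProduct (u : A g N) :
    ∑ y : A g N, (ZMod.stdAddChar (y ⬝ᵥ u) : ℂ) = if u = 0 then (N : ℂ) ^ g else 0 := by
  split_ifs with h
  · simp [h, ZMod.card]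
  · let φ : AddChar (A g N) ℂ :=
      { toFun := fun y => ZMod.stdAddChar (y ⬝ᵥ u)
        map_zero_eq_one' := by simp
        map_add_eq_mul' := fun a b => by simp [add_dotProduct, AddChar.map_add_eq_mul] }
    have hφ : φ ≠ 0 := by
      rintro h0
      apply h
      ext i
      have := DFunLike.congr_fun h0 (Pi.single i 1)
      simpa [φ, stdAddChar_eq_one_iff] using this
    exact AddChar.sum_eq_zero_iff_ne_zero.2 hφ

/-! ### The Weyl operators -/

theorem normWeyl_apply (h2 : IsUnit (2 : ZMod N)) (k : K g N) (f : L2 g N) (u : A g N) :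
    normWeyl k f u =
      ZMod.stdAddChar (k.2 ⬝ᵥ u - 2⁻¹ * (k.2 ⬝ᵥ k.1)) * f (u - k.1) := by
  have h : normWeyl k f u = chi k.2 ((2 : ZMod N)⁻¹ • k.1) * (chi k.2 (u - k.1) * f (u - k.1)) :=
    rfl
  rw [h, ← mul_assoc, chi, chi, ← AddChar.map_add_eq_mul]
  congr 2
  rw [dotProduct_smul, dotProduct_sub, smul_eq_mul]
  linear_combination (k.2 ⬝ᵥ k.1) * ZMod.inv_mul_of_unit (2 : ZMod N) h2

theorem normWeyl_zero (h2 : IsUnit (2 : ZMod N)) : normWeyl (0 : K g N) = LinearMap.id := by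
  ext f u
  simp [normWeyl_apply h2]

/-- The operators `𝒲_k` form a projective representation of `K` whose cocycle depends on the
alternating form only. This is why every element of `Aut(K, e)` carries it to a representation
with the same cocycle. -/
theorem normWeyl_comp (h2 : IsUnit (2 : ZMod N)) (k l : K g N) :
    normWeyl k ∘ₗ normWeyl l =
      (ZMod.stdAddChar (-(2⁻¹ * omega k l)) : ℂ) • normWeyl (k + l) := by
  refine LinearMap.ext fun f => ?_
  ext u
  change normWeyl k (normWeyl l f) u = ZMod.stdAddChar (-(2⁻¹ * omega k l)) * normWeyl (k + l) f u
  rw [normWeyl_apply h2, normWeyl_apply h2, normWeyl_apply h2, ← mul_assoc, ← mul_assoc,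
    ← AddChar.map_add_eq_mul, ← AddChar.map_add_eq_mul, sub_sub, Prod.fst_add]
  congr 2
  simp only [omega, Prod.snd_add, dotProduct_add, add_dotProduct, dotProduct_sub]
  linear_combination (l.2 ⬝ᵥ k.1) * ZMod.inv_mul_of_unit (2 : ZMod N) h2

theorem normWeyl_comp_apply (h2 : IsUnit (2 : ZMod N)) (k l : K g N) (f : L2 g N) :
    normWeyl k (normWeyl l f) =
      (ZMod.stdAddChar (-(2⁻¹ * omega k l)) : ℂ) • normWeyl (k + l) f :=
  LinearMap.congr_fun (normWeyl_comp h2 k l) f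

theorem normWeyl_neg_comp (h2 : IsUnit (2 : ZMod N)) (k : K g N) :
    normWeyl (-k) ∘ₗ normWeyl k = LinearMap.id := by
  rw [normWeyl_comp h2, neg_add_cancel, normWeyl_zero h2, omega_neg_left, omega_self]
  simp

/-- The commutation relation of the Weyl operators. -/
theorem normWeyl_conj (h2 : IsUnit (2 : ZMod N)) (k l : K g N) :
    normWeyl l ∘ₗ normWeyl k ∘ₗ normWeyl (-l) =
      (ZMod.stdAddChar (-omega l k) : ℂ) • normWeyl k := by
  rw [normWeyl_comp h2, LinearMap.comp_smul, normWeyl_comp h2, smul_smul,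
    ← AddChar.map_add_eq_mul]
  congr 2
  · simp only [omega_neg_right, omega_add_right, omega_self]
    linear_combination (-omega l k) * ZMod.inv_mul_of_unit (2 : ZMod N) h2 +
      (2 : ZMod N)⁻¹ * omega_swap k l
  · abel

theorem inner_normWeyl (h2 : IsUnit (2 : ZMod N)) (k : K g N) (f h : L2 g N) :
    inner ℂ (normWeyl k f) h = inner ℂ f (normWeyl (-k) h) := by
  simp only [PiLp.inner_apply, RCLike.inner_apply, normWeyl_apply h2]
  refine Fintype.sum_equiv (Equiv.subRight k.1) _ _ fun u => ?_
  simp only [Equiv.subRight_apply, map_mul, Prod.fst_neg, Prod.snd_neg, sub_neg_eq_add,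
    sub_add_cancel]
  have : (starRingEnd ℂ) (ZMod.stdAddChar (k.2 ⬝ᵥ u - 2⁻¹ * (k.2 ⬝ᵥ k.1))) =
      ZMod.stdAddChar (-k.2 ⬝ᵥ (u - k.1) - 2⁻¹ * (-k.2 ⬝ᵥ -k.1)) := by
    rw [← AddChar.map_neg_eq_conj]
    congr 1
    simp only [dotProduct_neg, neg_dotProduct, dotProduct_sub]
    linear_combination (-(k.2 ⬝ᵥ k.1)) * -ZMod.inv_mul_of_unit (2 : ZMod N) h2
  rw [this]
  ring

/-! ### Traces, completeness and Schur's lemma -/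

theorem trace_eq_sum (T : L2 g N →ₗ[ℂ] L2 g N) :
    LinearMap.trace ℂ (L2 g N) T = ∑ u, T (EuclideanSpace.single u 1) u := by
  rw [LinearMap.trace_eq_matrix_trace ℂ (EuclideanSpace.basisFun (A g N) ℂ).toBasis]
  simp [Matrix.trace, LinearMap.toMatrix_apply]

theorem ext_single {T S : L2 g N →ₗ[ℂ] L2 g N}
    (h : ∀ u v, T (EuclideanSpace.single u 1) v = S (EuclideanSpace.single u 1) v) : T = S := by
  refine (EuclideanSpace.basisFun (A g N) ℂ).toBasis.ext fun u => ?_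
  ext v
  simpa using h u v

/-- The Weyl operators are complete: an operator orthogonal to all of them for the trace form
vanishes, by Fourier inversion in the modulation variable. -/
theorem eq_zero_of_trace_normWeyl_comp (h2 : IsUnit (2 : ZMod N)) {T : L2 g N →ₗ[ℂ] L2 g N}
    (h : ∀ k : K g N, LinearMap.trace ℂ (L2 g N) (normWeyl k ∘ₗ T) = 0) : T = 0 := by
  refine ext_single fun w v => ?_
  -- The translation `x = w - v` picks out the values `(T δ_u)(u + v - w)`, and the Fourier sum
  -- over `y` the one with `u = w`.
  have key : ∑ y : A g N, (ZMod.stdAddChar (-(y ⬝ᵥ w - 2⁻¹ * (y ⬝ᵥ (w - v)))) : ℂ) *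
      LinearMap.trace ℂ (L2 g N) (normWeyl ((w - v, y) : K g N) ∘ₗ T) =
      N ^ g * T (EuclideanSpace.single w 1) v := by
    simp_rw [trace_eq_sum, Finset.mul_sum]
    rw [Finset.sum_comm]
    have (u : A g N) : ∑ y : A g N,
        (ZMod.stdAddChar (-(y ⬝ᵥ w - 2⁻¹ * (y ⬝ᵥ (w - v)))) : ℂ) *
        (normWeyl ((w - v, y) : K g N) ∘ₗ T) (EuclideanSpace.single u 1) u =
        if u = w then N ^ g * T (EuclideanSpace.single w 1) v else 0 := by
      simp_rw [LinearMap.comp_apply, normWeyl_apply h2, ← mul_assoc, ← AddChar.map_add_eq_mul]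
      rw [← Finset.sum_mul]
      have h3 : ∀ y : A g N, -(y ⬝ᵥ w - 2⁻¹ * (y ⬝ᵥ (w - v))) + (y ⬝ᵥ u - 2⁻¹ * (y ⬝ᵥ (w - v)))
          = y ⬝ᵥ (u - w) := fun y => by rw [dotProduct_sub y u w]; ring
      simp_rw [h3, sum_stdAddChar_dotProduct, sub_eq_zero]
      split_ifs with hu
      · simp [hu]
      · simp
    simp_rw [this]
    simp
  simp_rw [h] at key
  have hN : (N : ℂ) ^ g ≠ 0 := pow_ne_zero _ (NeZero.ne _)
  simpa [hN] using key.symm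

/-- Conjugation by `𝒲_l` fixes `T` and multiplies `𝒲_k` by a root of unity, which is not `1` for a
suitable `l`. -/
theorem trace_normWeyl_comp_of_commute (h2 : IsUnit (2 : ZMod N)) {T : L2 g N →ₗ[ℂ] L2 g N}
    (hT : ∀ k : K g N, T ∘ₗ normWeyl k = normWeyl k ∘ₗ T) {k : K g N} (hk : k ≠ 0) :
    LinearMap.trace ℂ (L2 g N) (normWeyl k ∘ₗ T) = 0 := by
  obtain ⟨l, hl⟩ : ∃ l, omega l k ≠ 0 := by
    by_contra! h
    exact hk (omega_eq_zero_of_forall h)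
  have h1 : normWeyl l ∘ₗ (normWeyl k ∘ₗ T) ∘ₗ normWeyl (-l) =
      (ZMod.stdAddChar (-omega l k) : ℂ) • (normWeyl k ∘ₗ T) := by
    rw [← LinearMap.smul_comp, ← normWeyl_conj h2 k l, LinearMap.comp_assoc, hT]
    simp only [LinearMap.comp_assoc]
  have h3 := congrArg (LinearMap.trace ℂ (L2 g N)) h1
  rw [LinearMap.trace_comp_comm', LinearMap.comp_assoc, normWeyl_neg_comp h2, LinearMap.comp_id,
    map_smul, smul_eq_mul, eq_comm, mul_left_eq_self₀, stdAddChar_eq_one_iff, neg_eq_zero] at h3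
  exact h3.resolve_left hl

theorem trace_id : LinearMap.trace ℂ (L2 g N) LinearMap.id = (N : ℂ) ^ g := by
  rw [LinearMap.trace_id, finrank_euclideanSpace]
  simp [ZMod.card]

theorem trace_normWeyl (h2 : IsUnit (2 : ZMod N)) (k : K g N) :
    LinearMap.trace ℂ (L2 g N) (normWeyl k) = if k = 0 then (N : ℂ) ^ g else 0 := by
  split_ifs with hk
  · rw [hk, normWeyl_zero h2, trace_id]
  · simpa using trace_normWeyl_comp_of_commute h2 (T := LinearMap.id) (fun _ => rfl) hk

/-- Schur's lemma for the Weyl operators. -/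
theorem eq_smul_id_of_commute (h2 : IsUnit (2 : ZMod N)) {T : L2 g N →ₗ[ℂ] L2 g N}
    (hT : ∀ k : K g N, T ∘ₗ normWeyl k = normWeyl k ∘ₗ T) :
    ∃ c : ℂ, T = c • LinearMap.id := by
  have hN : (N : ℂ) ^ g ≠ 0 := pow_ne_zero _ (NeZero.ne _)
  refine ⟨LinearMap.trace ℂ (L2 g N) T / N ^ g, ?_⟩
  rw [← sub_eq_zero]
  refine eq_zero_of_trace_normWeyl_comp h2 fun k => ?_
  by_cases hk : k = 0
  · rw [hk, normWeyl_zero h2, LinearMap.id_comp, map_sub, map_smul, trace_id, smul_eq_mul,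
      div_mul_cancel₀ _ hN, sub_self]
  · refine trace_normWeyl_comp_of_commute h2 (fun l => ?_) hk
    rw [LinearMap.sub_comp, LinearMap.comp_sub, hT, LinearMap.smul_comp, LinearMap.comp_smul,
      LinearMap.id_comp, LinearMap.comp_id]

/-! ### Existence of a Weil representation -/

/-- Averaging an operator `B` over `K` intertwines `k ↦ 𝒲_k` and `k ↦ 𝒲_{a k}`; for a suitable
rank-one `B` the average is not zero, since otherwise the trace of a combination of the `𝒲_{a k}`
with nonzero coefficient at `k = 0` would vanish. -/
theorem exists_intertwiner (h2 : IsUnit (2 : ZMod N)) (a : autKe g N) :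
    ∃ T : L2 g N →ₗ[ℂ] L2 g N, T ≠ 0 ∧ ∀ k, T ∘ₗ normWeyl k = normWeyl (a.1 k) ∘ₗ T := by
  let S (B : L2 g N →ₗ[ℂ] L2 g N) : L2 g N →ₗ[ℂ] L2 g N :=
    ∑ k : K g N, normWeyl (a.1 k) ∘ₗ B ∘ₗ normWeyl (-k)
  have hS (B) (l : K g N) : S B ∘ₗ normWeyl l = normWeyl (a.1 l) ∘ₗ S B := by
    refine LinearMap.ext fun f => ?_
    simp only [S, LinearMap.comp_apply, LinearMap.sum_apply, map_sum]
    refine Fintype.sum_equiv (Equiv.subRight l) _ _ fun k => ?_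
    simp only [Equiv.subRight_apply, neg_sub]
    rw [normWeyl_comp_apply h2, normWeyl_comp_apply h2, map_smul, map_smul, autKe_omega,
      ← map_add, add_sub_cancel, neg_add_eq_sub, sub_eq_add_neg k l, omega_add_right,
      omega_neg_right, omega_self, neg_zero, add_zero, omega_neg_left, omega_swap k l, neg_neg]
  by_contra! hc
  have h0 (B) : S B = 0 := by
    by_contra hB
    obtain ⟨k, hk⟩ := hc (S B) hB
    exact hk (hS B k)
  let u : L2 g N := EuclideanSpace.single 0 1
  -- The average of the rank-one operator `f ↦ f(0) v`, at the point mass `u` at `0`, for all `v`.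
  have h1 : ∑ k : K g N, (normWeyl (-k) u 0) • normWeyl (a.1 k) = (0 : L2 g N →ₗ[ℂ] L2 g N) := by
    refine LinearMap.ext fun v => ?_
    have := LinearMap.congr_fun
      (h0 ((EuclideanSpace.proj (0 : A g N) : L2 g N →L[ℂ] ℂ).toLinearMap.smulRight v)) u
    simpa [S, LinearMap.sum_apply] using this
  have h3 := congrArg (LinearMap.trace ℂ (L2 g N)) h1
  have hN : (N : ℂ) ^ g ≠ 0 := pow_ne_zero _ (NeZero.ne _)
  simp [map_sum, trace_normWeyl h2, normWeyl_zero h2, u] at h3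
  exact hN (by simpa using h3)

theorem exists_weilOperator (h2 : IsUnit (2 : ZMod N)) (a : autKe g N) :
    ∃ W : L2 g N ≃ₗᵢ[ℂ] L2 g N, ∀ k f, W (normWeyl k (W.symm f)) = normWeyl (a.1 k) f := by
  obtain ⟨T, hT0, hT⟩ := exists_intertwiner h2 a
  have hT' (k f) : T (normWeyl k f) = normWeyl (a.1 k) (T f) := LinearMap.congr_fun (hT k) f
  -- `T* T` commutes with the Weyl operators, so `T` is a multiple of an isometry.
  obtain ⟨c, hc⟩ := eq_smul_id_of_commute h2 (T := T.adjoint ∘ₗ T) fun k => by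
    refine LinearMap.ext fun f => ext_inner_right ℂ fun h => ?_
    simp only [LinearMap.comp_apply]
    rw [LinearMap.adjoint_inner_left, hT', inner_normWeyl h2, ← map_neg, ← hT', inner_normWeyl h2,
      LinearMap.adjoint_inner_left]
  have hn (f : L2 g N) : ‖T f‖ ^ 2 = c.re * ‖f‖ ^ 2 := by
    have h : inner ℂ f (T.adjoint (T f)) = c * inner ℂ f f := by
      rw [← LinearMap.comp_apply, hc, LinearMap.smul_apply, inner_smul_right, LinearMap.id_apply]
    rw [LinearMap.adjoint_inner_right, inner_self_eq_norm_sq_to_K, inner_self_eq_norm_sq_to_K] at h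
    have := congrArg Complex.re h
    simpa [← Complex.ofReal_pow] using this
  have hcpos : 0 < c.re := by
    obtain ⟨f, hf⟩ : ∃ f, T f ≠ 0 := by
      by_contra! h
      exact hT0 (LinearMap.ext h)
    have h1 := hn f
    have h3 : 0 < ‖T f‖ ^ 2 := by positivity
    by_contra! h4
    nlinarith [sq_nonneg ‖f‖]
  have hs : 0 < √c.re := Real.sqrt_pos.2 hcpos
  let I : L2 g N →ₗᵢ[ℂ] L2 g N :=
    { toLinearMap := (((√c.re)⁻¹ : ℝ) : ℂ) • T
      norm_map' := fun f => by
        have h : ‖T f‖ = √c.re * ‖f‖ := by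
          rw [← Real.sqrt_sq (norm_nonneg (T f)), hn, Real.sqrt_mul hcpos.le,
            Real.sqrt_sq (norm_nonneg f)]
        rw [LinearMap.smul_apply, norm_smul, h, Complex.norm_real,
          Real.norm_of_nonneg (by positivity)]
        field_simp }
  let W := I.toLinearIsometryEquiv rfl
  have hW (f) : W f = (((√c.re)⁻¹ : ℝ) : ℂ) • T f := rfl
  refine ⟨W, fun k f => ?_⟩
  obtain ⟨f, rfl⟩ := W.surjective f
  rw [W.symm_apply_apply, hW, hW, map_smul, hT']

theorem exists_isWeilRep (h2 : IsUnit (2 : ZMod N)) :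
    ∃ W : autKe g N → (L2 g N ≃ₗᵢ[ℂ] L2 g N), IsWeilRep W := by
  choose W hW using exists_weilOperator (g := g) h2
  exact ⟨W, hW⟩

end Weyl

/-! ### The parity operator and fixed spaces of isotropic subgroups -/

section Parity

variable {g N : ℕ}

/-- The parity operator `(P f)(u) = f (-u)`. -/
def parity : L2 g N →ₗ[ℂ] L2 g N where
  toFun f := WithLp.toLp 2 fun u => f (-u)
  map_add' _ _ := rfl
  map_smul' _ _ := rfl

@[simp]
theorem parity_apply (f : L2 g N) (u : A g N) : parity f u = f (-u) := rfl

@[simp]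
theorem parity_parity (f : L2 g N) : parity (parity f) = f := by
  ext u
  simp

variable [NeZero N]

/-- The sum of all Weyl operators is a multiple of the parity operator. -/
theorem sum_normWeyl (h2 : IsUnit (2 : ZMod N)) (f : L2 g N) :
    ∑ k : K g N, normWeyl k f = (N : ℂ) ^ g • parity f := by
  ext u
  have h21 := ZMod.inv_mul_of_unit (2 : ZMod N) h2
  have h (y x : A g N) : y ⬝ᵥ u - 2⁻¹ * (y ⬝ᵥ x) = y ⬝ᵥ (u - (2 : ZMod N)⁻¹ • x) := by
    rw [dotProduct_sub, dotProduct_smul, smul_eq_mul]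
  have hx (x : A g N) : u - (2 : ZMod N)⁻¹ • x = 0 ↔ x = (2 : ZMod N) • u := by
    rw [sub_eq_zero]
    constructor
    · rintro rfl
      rw [smul_smul, mul_comm, h21, one_smul]
    · rintro rfl
      rw [smul_smul, h21, one_smul]
  rw [WithLp.ofLp_sum, Finset.sum_apply, Fintype.sum_prod_type]
  simp_rw [normWeyl_apply h2, ← Finset.sum_mul, h, sum_stdAddChar_dotProduct, hx, ite_mul, zero_mul]
  rw [Finset.sum_ite_eq' Finset.univ]
  simp [two_smul]

theorem parity_normWeyl (h2 : IsUnit (2 : ZMod N)) (k : K g N) (f : L2 g N) :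
    parity (normWeyl k f) = normWeyl (-k) (parity f) := by
  ext u
  have h : -(u - (-k).1) = -u - k.1 := by
    rw [Prod.fst_neg]
    abel
  rw [parity_apply, normWeyl_apply h2, normWeyl_apply h2, parity_apply, h]
  simp

/-- The operator `P 𝒲_k` permutes the lines spanned by the point masses and fixes only that at
`-x/2`, where `k = (x, y)`. -/
theorem trace_parity_comp_normWeyl (h2 : IsUnit (2 : ZMod N)) (k : K g N) :
    LinearMap.trace ℂ (L2 g N) (parity ∘ₗ normWeyl k) = 1 := by
  have h21 := ZMod.inv_mul_of_unit (2 : ZMod N) h2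
  have hu (u : A g N) : u = -u - k.1 ↔ u = -((2 : ZMod N)⁻¹ • k.1) := by
    constructor
    · intro h
      have h3 : k.1 = -((2 : ZMod N) • u) := by
        rw [two_smul]
        nth_rw 1 [h]
        abel
      rw [h3, smul_neg, smul_smul, h21, one_smul, neg_neg]
    · rintro rfl
      have h3 : k.1 = (2 : ZMod N) • ((2 : ZMod N)⁻¹ • k.1) := by
        rw [smul_smul, mul_comm, h21, one_smul]
      nth_rw 3 [h3]
      rw [two_smul]
      abel
  rw [trace_eq_sum]
  simp_rw [LinearMap.comp_apply, parity_apply, normWeyl_apply h2, PiLp.single_apply]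
  rw [Finset.sum_eq_single (-((2 : ZMod N)⁻¹ • k.1))]
  · rw [if_pos ((hu _).2 rfl).symm, mul_one, stdAddChar_eq_one_iff, neg_neg, dotProduct_smul,
      smul_eq_mul, sub_self]
  · intro u _ h
    rw [if_neg, mul_zero]
    exact fun h3 => h ((hu u).1 h3.symm)
  · simp

/-- The parity operator commutes with the Weil operators, because it is proportional to the sum of
the `𝒲_k` over all of `K`. -/
theorem parity_commute (h2 : IsUnit (2 : ZMod N)) (a : autKe g N) (W : L2 g N ≃ₗᵢ[ℂ] L2 g N)
    (hW : ∀ k f, W (normWeyl k f) = normWeyl (a.1 k) (W f)) (f : L2 g N) :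
    W (parity f) = parity (W f) := by
  have hN : (N : ℂ) ^ g ≠ 0 := pow_ne_zero _ (NeZero.ne _)
  refine smul_right_injective _ hN ?_
  simp only
  rw [← map_smul, ← sum_normWeyl h2, ← sum_normWeyl h2, map_sum]
  simp_rw [hW]
  exact Equiv.sum_comp a.1.toEquiv fun k => normWeyl k (W f)

/-- The dimension of the space of vectors of parity `ε` fixed by the Weyl operators of an isotropic
subgroup `H`, as the trace of the projection `(1 + ε P) / 2 · |H|⁻¹ ∑_{k ∈ H} 𝒲_k` onto it. -/
theorem finrank_fixed_parity (h2 : IsUnit (2 : ZMod N)) (H : AddSubgroup (K g N))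
    (hH : ∀ k ∈ H, ∀ l ∈ H, omega k l = 0) (ε : ℤˣ) (X : Submodule ℂ (L2 g N))
    (hX : ∀ f, f ∈ X ↔ (∀ k ∈ H, normWeyl k f = f) ∧ parity f = ((ε : ℤ) : ℂ) • f) :
    2 * (finrank ℂ X : ℂ) * Nat.card H = (N : ℂ) ^ g + (ε : ℤ) * Nat.card H := by
  classical
  set c : ℂ := (Nat.card H : ℂ)
  have hc : c ≠ 0 := Nat.cast_ne_zero.2 Nat.card_pos.ne'
  have hε : ((ε : ℤ) : ℂ) * ((ε : ℤ) : ℂ) = 1 := by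
    rcases Int.units_eq_one_or ε with rfl | rfl <;> simp
  let S : L2 g N →ₗ[ℂ] L2 g N := ∑ k : H, normWeyl (k : K g N)
  have hS (f) : S f = ∑ k : H, normWeyl (k : K g N) f := LinearMap.sum_apply _ _ _
  have hS1 (k) (hk : k ∈ H) (f) : normWeyl k (S f) = S f := by
    simp_rw [hS, map_sum]
    refine Fintype.sum_equiv (Equiv.addLeft ⟨k, hk⟩) _ _ fun l => ?_
    rw [normWeyl_comp_apply h2, hH k hk l l.2]
    simp
  have hS2 (f) : parity (S f) = S (parity f) := by
    simp_rw [hS, map_sum, parity_normWeyl h2]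
    exact Fintype.sum_equiv (Equiv.neg H) _ _ fun l => by simp
  let Q : L2 g N →ₗ[ℂ] L2 g N := (2 * c)⁻¹ • (S + ((ε : ℤ) : ℂ) • (parity ∘ₗ S))
  have hQ (f) : Q f = (2 * c)⁻¹ • (S f + ((ε : ℤ) : ℂ) • parity (S f)) := rfl
  have hproj : LinearMap.IsProj X Q := by
    refine ⟨fun f => (hX _).2 ⟨fun k hk => ?_, ?_⟩, fun f hf => ?_⟩
    · rw [hQ, hS2, map_smul, map_add, map_smul, hS1 k hk, hS1 k hk]
    · rw [hQ, map_smul, map_add, map_smul, parity_parity, smul_comm, smul_add _ (S f), smul_smul,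
        hε, one_smul, add_comm]
    · obtain ⟨h1, h3⟩ := (hX f).1 hf
      have h4 : S f = c • f := by
        rw [hS, Finset.sum_congr rfl fun k _ => h1 k.1 k.2, Finset.sum_const, Finset.card_univ,
          ← Nat.card_eq_fintype_card, ← Nat.cast_smul_eq_nsmul ℂ]
      rw [hQ, h4, map_smul, h3, smul_comm c, smul_smul, hε, one_smul, ← two_smul ℂ, smul_smul,
        smul_smul, mul_assoc, inv_mul_cancel₀ (by simpa using hc), one_smul]
  have h1 : LinearMap.trace ℂ (L2 g N) S = (N : ℂ) ^ g := by
    simp only [S, map_sum, trace_normWeyl h2]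
    rw [Finset.sum_eq_single 0]
    · simp
    · exact fun k _ hk => if_neg (by simpa using hk)
    · simp
  have h3 : LinearMap.trace ℂ (L2 g N) (parity ∘ₗ S) = c := by
    have : parity ∘ₗ S = ∑ k : H, parity ∘ₗ normWeyl (k : K g N) := by
      ext f : 1
      simp [hS, map_sum, LinearMap.sum_apply]
    rw [this, map_sum]
    simp [trace_parity_comp_normWeyl h2, c]
  have h4 := hproj.trace
  rw [map_smul, map_add, map_smul, h1, h3, smul_eq_mul, smul_eq_mul] at h4
  rw [← h4]
  field_simp

end Parity

/-! ### The subgroups `p^m K` and the spaces `V_{n-2r}^ε` -/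

section PowSubgroup

variable {g p n : ℕ}

theorem mem_powSubgroup {N m : ℕ} {u : A g N} :
    u ∈ powSubgroup g N p m ↔ ∃ v : A g N, (p : ZMod N) ^ m • v = u := by
  simp only [powSubgroup, AddMonoidHom.mem_range, nsmulAddMonoidHom_apply]
  refine exists_congr fun v => ?_
  rw [← Nat.cast_smul_eq_nsmul (ZMod N), Nat.cast_pow]

/-- The subgroup `p^m K` of `K`. -/
def powSubgroupK (g N p m : ℕ) : AddSubgroup (K g N) :=
  (powSubgroup g N p m).prod (powSubgroup g N p m)

theorem mem_powSubgroupK {N m : ℕ} {k : K g N} :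
    k ∈ powSubgroupK g N p m ↔ ∃ l : K g N, (p : ZMod N) ^ m • l = k := by
  rw [powSubgroupK, AddSubgroup.mem_prod, mem_powSubgroup, mem_powSubgroup]
  constructor
  · rintro ⟨⟨x, hx⟩, ⟨y, hy⟩⟩
    exact ⟨(x, y), Prod.ext hx hy⟩
  · rintro ⟨l, rfl⟩
    exact ⟨⟨l.1, rfl⟩, ⟨l.2, rfl⟩⟩

theorem pow_cast_eq_zero {m : ℕ} (hm : n ≤ m) : (p : ZMod (p ^ n)) ^ m = 0 := by
  rw [← Nat.cast_pow, ZMod.natCast_eq_zero_iff]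
  exact pow_dvd_pow p hm

theorem isUnit_two (hp : Odd p) : IsUnit (2 : ZMod (p ^ n)) := by
  have h : Nat.Coprime 2 (p ^ n) := by
    rw [Nat.coprime_two_left]
    exact hp.pow
  exact_mod_cast (ZMod.isUnit_iff_coprime 2 (p ^ n)).2 h

theorem omega_eq_zero_of_mem_powSubgroupK {m : ℕ} (hm : n ≤ 2 * m) {k l : K g (p ^ n)}
    (hk : k ∈ powSubgroupK g (p ^ n) p m) (hl : l ∈ powSubgroupK g (p ^ n) p m) :
    omega k l = 0 := by
  obtain ⟨k, rfl⟩ := mem_powSubgroupK.1 hk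
  obtain ⟨l, rfl⟩ := mem_powSubgroupK.1 hl
  rw [omega_smul_left, omega_smul_right, ← mul_assoc, ← pow_add, pow_cast_eq_zero (by omega),
    zero_mul]

theorem autKe_smul {N : ℕ} [NeZero N] (a : autKe g N) (c : ZMod N) (k : K g N) :
    a.1 (c • k) = c • a.1 k := ZMod.map_smul (a.1 : K g N →+ K g N) c k

variable [Fact p.Prime]

theorem pow_dvd_of_pow_mul_eq_zero {r : ℕ} (hr : r ≤ n) {x : ZMod (p ^ n)}
    (h : (p : ZMod (p ^ n)) ^ (n - r) * x = 0) : (p : ZMod (p ^ n)) ^ r ∣ x := by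
  have hp : 0 < p := (Fact.out : p.Prime).pos
  rw [← ZMod.natCast_zmod_val x, ← Nat.cast_pow, ← Nat.cast_mul, ZMod.natCast_eq_zero_iff] at h
  nth_rw 1 [← Nat.sub_add_cancel hr] at h
  rw [pow_add] at h
  have h1 : p ^ r ∣ x.val := Nat.dvd_of_mul_dvd_mul_left (pow_pos hp _) h
  rw [← ZMod.natCast_zmod_val x, ← Nat.cast_pow]
  exact Nat.cast_dvd_cast h1

theorem card_powSubgroup {m : ℕ} (hm : m ≤ n) :
    Nat.card (powSubgroup g (p ^ n) p m) = p ^ (g * (n - m)) := by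
  have hp : 0 < p := (Fact.out : p.Prime).pos
  let R : AddSubgroup (ZMod (p ^ n)) := AddSubgroup.zmultiples ((p ^ m : ℕ) : ZMod (p ^ n))
  have hR : Nat.card R = p ^ (n - m) := by
    rw [Nat.card_zmultiples, ZMod.addOrderOf_coe _ (pow_pos hp n).ne',
      Nat.gcd_eq_right (pow_dvd_pow p hm), Nat.pow_div hm hp]
  have hmem (u : A g (p ^ n)) : u ∈ powSubgroup g (p ^ n) p m ↔ ∀ i, u i ∈ R := by
    rw [mem_powSubgroup]
    constructor
    · rintro ⟨v, rfl⟩ i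
      rw [AddSubgroup.mem_zmultiples_iff]
      refine ⟨(v i).val, ?_⟩
      simp [mul_comm]
    · intro h
      choose c hc using fun i => AddSubgroup.mem_zmultiples_iff.1 (h i)
      refine ⟨fun i => c i, funext fun i => ?_⟩
      rw [← hc]
      simp [mul_comm]
  rw [Nat.card_congr ((Equiv.subtypeEquivRight hmem).trans
    (Equiv.subtypePiEquivPi (β := fun _ : Fin g => ZMod (p ^ n)) (p := fun _ b => b ∈ R)))]
  rw [Nat.card_pi]
  simp only [Finset.prod_const, Finset.card_univ, Fintype.card_fin]
  rw [mul_comm, pow_mul, ← hR]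

theorem card_powSubgroupK {m : ℕ} (hm : m ≤ n) :
    Nat.card (powSubgroupK g (p ^ n) p m) = p ^ (2 * (g * (n - m))) := by
  rw [powSubgroupK, Nat.card_congr (AddSubgroup.prodEquiv _ _).toEquiv, Nat.card_prod,
    card_powSubgroup hm]
  ring

/-- `V_{n-2r}^ε` consists of the vectors of parity `ε` fixed by the Weyl operators of
`p^{n-r} K`: translations give the invariance and modulations the support condition. -/
theorem mem_V_iff (hp : Odd p) {r : ℕ} (hr : r ≤ n / 2) (ε : ℤˣ) (f : L2 g (p ^ n)) :
    f ∈ V g p n r ε ↔ (∀ k ∈ powSubgroupK g (p ^ n) p (n - r), normWeyl k f = f) ∧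
      parity f = ((ε : ℤ) : ℂ) • f := by
  have h2 : IsUnit (2 : ZMod (p ^ n)) := isUnit_two hp
  have hparity : (∀ u, f (-u) = ((ε : ℤ) : ℂ) * f u) ↔ parity f = ((ε : ℤ) : ℂ) • f :=
    ⟨fun h => by ext u; exact h u, fun h u => congrArg (fun q : L2 g (p ^ n) => q u) h⟩
  rw [← hparity]
  change (_ ∧ _ ∧ _) ↔ _
  rw [← and_assoc]
  refine and_congr_left fun _ => ⟨?_, fun h => ⟨fun u hu => ?_, fun t ht u => ?_⟩⟩
  · rintro ⟨hsupp, hinv⟩ k hk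
    obtain ⟨l, rfl⟩ := mem_powSubgroupK.1 hk
    ext u
    rw [normWeyl_apply h2, sub_eq_add_neg u, Prod.smul_fst,
      hinv _ (neg_mem (mem_powSubgroup.2 ⟨l.1, rfl⟩))]
    by_cases hu : u ∈ powSubgroup g (p ^ n) p r
    · obtain ⟨v, rfl⟩ := mem_powSubgroup.1 hu
      simp only [Prod.smul_snd, smul_dotProduct, dotProduct_smul, smul_eq_mul]
      rw [← mul_assoc, ← pow_add, ← mul_assoc (_ ^ _) (_ ^ _), ← pow_add,
        pow_cast_eq_zero (by omega), pow_cast_eq_zero (by omega)]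
      simp
    · simp [hsupp u hu]
  · by_contra hf
    apply hu
    have h1 (i : Fin g) : (p : ZMod (p ^ n)) ^ r ∣ u i := by
      apply pow_dvd_of_pow_mul_eq_zero (by omega)
      have h3 := congrArg (fun q : L2 g (p ^ n) => q u)
        (h ((p : ZMod (p ^ n)) ^ (n - r) • (0, Pi.single i 1)) (mem_powSubgroupK.2 ⟨_, rfl⟩))
      simp only [normWeyl_apply h2] at h3
      simpa [hf, smul_dotProduct, stdAddChar_eq_one_iff] using h3
    choose v hv using h1
    exact mem_powSubgroup.2 ⟨v, funext fun i => (hv i).symm⟩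
  · obtain ⟨v, rfl⟩ := mem_powSubgroup.1 ht
    have h3 := congrArg (fun q : L2 g (p ^ n) => q (u + (p : ZMod (p ^ n)) ^ (n - r) • v))
      (h ((p : ZMod (p ^ n)) ^ (n - r) • (v, 0)) (mem_powSubgroupK.2 ⟨_, rfl⟩))
    simpa [normWeyl_apply h2] using h3.symm

theorem two_mul_finrank_V (hp : Odd p) {r : ℕ} (hr : r ≤ n / 2) (ε : ℤˣ) :
    2 * (finrank ℂ (V g p n r ε) : ℚ) = (p : ℚ) ^ (g * (n - 2 * r)) + (ε : ℤ) := by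
  have hp0 : (p : ℂ) ≠ 0 := Nat.cast_ne_zero.2 (Fact.out : p.Prime).ne_zero
  have h := finrank_fixed_parity (isUnit_two hp) (powSubgroupK g (p ^ n) p (n - r))
    (fun k hk l hl => omega_eq_zero_of_mem_powSubgroupK (by omega) hk hl) ε (V g p n r ε)
    (mem_V_iff hp hr ε)
  rw [card_powSubgroupK (by omega), Nat.sub_sub_self (by omega)] at h
  have h1 : ((p ^ n : ℕ) : ℂ) ^ g = (p : ℂ) ^ (g * (n - 2 * r)) * (p : ℂ) ^ (2 * (g * r)) := by
    obtain ⟨m, rfl⟩ : ∃ m, n = m + 2 * r := ⟨n - 2 * r, by omega⟩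
    rw [Nat.add_sub_cancel]
    push_cast
    ring
  rw [h1, Nat.cast_pow, ← add_mul] at h
  have h3 := mul_right_cancel₀ (pow_ne_zero _ hp0) h
  exact_mod_cast h3

/-- The spaces `V_{n-2r}^ε` are invariant under every Weil representation, since `p^{n-r} K` is
characteristic and the parity operator commutes with the representation. -/
theorem isInvariant_V (hp : Odd p) {r : ℕ} (hr : r ≤ n / 2) (ε : ℤˣ)
    {W : autKe g (p ^ n) → (L2 g (p ^ n) ≃ₗᵢ[ℂ] L2 g (p ^ n))} (hW : IsWeilRep W) :
    IsInvariant W (V g p n r ε) := by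
  intro a f hf
  have hWa (k f) : W a (normWeyl k f) = normWeyl (a.1 k) (W a f) := by
    simpa using hW a k (W a f)
  rw [mem_V_iff hp hr] at hf ⊢
  refine ⟨fun k hk => ?_, ?_⟩
  · have hk' : a.1.symm k ∈ powSubgroupK g (p ^ n) p (n - r) := by
      obtain ⟨l, rfl⟩ := mem_powSubgroupK.1 hk
      exact mem_powSubgroupK.2
        ⟨a.1.symm l, (ZMod.map_smul (a.1.symm : K g (p ^ n) →+ K g (p ^ n)) _ l).symm⟩
    rw [← a.1.apply_symm_apply k, ← hWa, hf.1 _ hk']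
  · rw [← parity_commute (isUnit_two hp) a (W a) hWa, hf.2, map_smul]

end PowSubgroup

/-! ### Transitivity on primitive vectors -/

section Transitivity

variable {g N : ℕ} [NeZero N]

/-- The symplectic transvection `k ↦ k + c ω(k, v) v`. -/
def transvection (c : ZMod N) (v : K g N) : autKe g N where
  val :=
    { toFun := fun k => k + (c * omega k v) • v
      invFun := fun k => k - (c * omega k v) • v
      left_inv := fun k => by
        simp [omega_add_left, omega_smul_left, omega_self]
      right_inv := fun k => by
        simp [sub_eq_add_neg, omega_add_left, omega_neg_left, omega_smul_left, omega_self]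
      map_add' := fun k l => by
        rw [omega_add_left, mul_add, add_smul]
        abel }
  property := fun k l => by
    rw [e_eq_stdAddChar_omega, e_eq_stdAddChar_omega]
    congr 1
    simp only [AddEquiv.coe_mk, Equiv.coe_fn_mk, omega_add_left, omega_add_right, omega_smul_left,
      omega_smul_right, omega_self, mul_zero, add_zero]
    rw [omega_swap v l]
    ring

theorem exists_autKe_of_isUnit_omega {k l : K g N} (h : IsUnit (omega k l)) :
    ∃ a : autKe g N, a.1 k = l := by
  refine ⟨transvection (omega k l)⁻¹ (l - k), ?_⟩
  change k + ((omega k l)⁻¹ * omega k (l - k)) • (l - k) = l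
  rw [sub_eq_add_neg l k, omega_add_right, omega_neg_right, omega_self, neg_zero, add_zero,
    ZMod.inv_mul_of_unit _ h, one_smul]
  abel

theorem exists_autKe_trans {k l m : K g N} (h : ∃ a : autKe g N, a.1 k = l)
    (h' : ∃ a : autKe g N, a.1 l = m) : ∃ a : autKe g N, a.1 k = m := by
  obtain ⟨a, rfl⟩ := h
  obtain ⟨b, rfl⟩ := h'
  exact ⟨⟨a.1.trans b.1, fun k l => (b.2 _ _).trans (a.2 k l)⟩, rfl⟩

end Transitivity

section Orbits

variable {g p n : ℕ} [Fact p.Prime]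

theorem dvd_of_not_isUnit {x : ZMod (p ^ n)} (hx : ¬ IsUnit x) : (p : ZMod (p ^ n)) ∣ x := by
  rw [← ZMod.natCast_zmod_val x] at hx ⊢
  rw [ZMod.isUnit_iff_coprime] at hx
  refine Nat.cast_dvd_cast (((Fact.out : p.Prime).dvd_iff_not_coprime).2 fun h => hx ?_)
  exact Nat.Coprime.pow_right n h.symm

theorem isUnit_add_of_not_isUnit {x y : ZMod (p ^ n)} (hx : IsUnit x) (hy : ¬ IsUnit y) :
    IsUnit (x + y) := by
  obtain ⟨z, rfl⟩ := dvd_of_not_isUnit hy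
  have h : IsNilpotent ((p : ZMod (p ^ n)) * z) :=
    ⟨n, by rw [mul_pow, pow_cast_eq_zero le_rfl, zero_mul]⟩
  exact h.isUnit_add_left_of_commute hx (Commute.all _ _)

/-- The group `Aut(K, e)` is transitive on primitive vectors. Two of them are joined by at most two
transvections, through a vector `m` pairing to a unit with both. -/
theorem exists_autKe_of_primitive {k l : K g (p ^ n)} (hk : ∃ m, IsUnit (omega k m))
    (hl : ∃ m, IsUnit (omega m l)) : ∃ a : autKe g (p ^ n), a.1 k = l := by
  -- `ℤ/p^n` is local: if neither `s` nor `t` serves for both `k` and `l`, then `s + t` does.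
  obtain ⟨m, h1, h2⟩ : ∃ m, IsUnit (omega k m) ∧ IsUnit (omega m l) := by
    obtain ⟨s, hs⟩ := hk
    obtain ⟨t, ht⟩ := hl
    by_cases hs' : IsUnit (omega s l)
    · exact ⟨s, hs, hs'⟩
    by_cases ht' : IsUnit (omega k t)
    · exact ⟨t, ht', ht⟩
    refine ⟨s + t, ?_, ?_⟩
    · rw [omega_add_right]
      exact isUnit_add_of_not_isUnit hs ht'
    · rw [omega_add_left, add_comm]
      exact isUnit_add_of_not_isUnit ht hs'
  exact exists_autKe_trans (exists_autKe_of_isUnit_omega h1) (exists_autKe_of_isUnit_omega h2)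

theorem exists_isUnit_omega_or_eq_smul (k : K g (p ^ n)) :
    (∃ m, IsUnit (omega m k)) ∨ ∃ l, k = (p : ZMod (p ^ n)) • l := by
  rw [or_iff_not_imp_left]
  intro h
  have h1 (i : Fin g) : (p : ZMod (p ^ n)) ∣ k.1 i := dvd_of_not_isUnit fun hu =>
    h ⟨(0, Pi.single i 1), by simpa [omega] using hu⟩
  have h2 (i : Fin g) : (p : ZMod (p ^ n)) ∣ k.2 i := dvd_of_not_isUnit fun hu =>
    h ⟨(Pi.single i 1, 0), by simpa [omega] using hu⟩
  choose x hx using h1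
  choose y hy using h2
  exact ⟨(x, y), Prod.ext (funext hx) (funext hy)⟩

/-- A vector is `p^j` times a primitive vector for some `j < m`, or divisible by `p^m`. -/
theorem exists_eq_pow_smul_primitive (k : K g (p ^ n)) (m : ℕ) :
    (∃ j < m, ∃ l, (∃ t, IsUnit (omega t l)) ∧ k = (p : ZMod (p ^ n)) ^ j • l) ∨
      ∃ l, k = (p : ZMod (p ^ n)) ^ m • l := by
  induction m with
  | zero => exact Or.inr ⟨k, by simp⟩
  | succ m ih =>
    rcases ih with ⟨j, hj, l, hl⟩ | ⟨l, hl⟩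
    · exact Or.inl ⟨j, by omega, l, hl⟩
    · rcases exists_isUnit_omega_or_eq_smul l with h | ⟨l', rfl⟩
      · exact Or.inl ⟨m, by omega, l, h, hl⟩
      · exact Or.inr ⟨l', by rw [hl, smul_smul, pow_succ]⟩

/-- Every orbit of `Aut(K, e)` on `K` contains one of the `n + 1` vectors `p^j k₀`, for `k₀` a
primitive vector. -/
theorem exists_autKe_pow_smul {k₀ : K g (p ^ n)} (hk₀ : ∃ m, IsUnit (omega k₀ m))
    (k : K g (p ^ n)) :
    ∃ (j : Fin (n + 1)) (a : autKe g (p ^ n)), a.1 ((p : ZMod (p ^ n)) ^ (j : ℕ) • k₀) = k := by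
  rcases exists_eq_pow_smul_primitive k n with ⟨j, hj, l, hl, rfl⟩ | ⟨l, rfl⟩
  · obtain ⟨a, rfl⟩ := exists_autKe_of_primitive hk₀ hl
    exact ⟨⟨j, by omega⟩, a, autKe_smul a _ _⟩
  · exact ⟨⟨n, by omega⟩, transvection 0 0, by simp [pow_cast_eq_zero (p := p) le_rfl]⟩

/-! ### The commutant of a Weil representation -/

section Commutant

/-- The operators commuting with all `W a`. -/
def commutant {N : ℕ} [NeZero N] (W : autKe g N → (L2 g N ≃ₗᵢ[ℂ] L2 g N)) :
    Submodule ℂ (L2 g N →ₗ[ℂ] L2 g N) where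
  carrier := {T | ∀ a f, T (W a f) = W a (T f)}
  add_mem' hT hS a f := by simp [hT a f, hS a f]
  zero_mem' a f := by simp
  smul_mem' c T hT a f := by simp [hT a f]

theorem trace_normWeyl_autKe_comp {N : ℕ} [NeZero N]
    {W : autKe g N → (L2 g N ≃ₗᵢ[ℂ] L2 g N)} (hW : IsWeilRep W) {T : L2 g N →ₗ[ℂ] L2 g N}
    (hT : T ∈ commutant W) (a : autKe g N) (k : K g N) :
    LinearMap.trace ℂ (L2 g N) (normWeyl (a.1 k) ∘ₗ T) =
      LinearMap.trace ℂ (L2 g N) (normWeyl k ∘ₗ T) := by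
  rw [← LinearMap.trace_conj' (normWeyl k ∘ₗ T) (W a).toLinearEquiv]
  congr 1
  refine LinearMap.ext fun f => ?_
  have h : normWeyl (a.1 k) (T f) = W a (normWeyl k (T ((W a).symm f))) := by
    rw [← hW a k]
    congr 2
    rw [LinearIsometryEquiv.symm_apply_eq, ← hT, LinearIsometryEquiv.apply_symm_apply]
  exact h

/-- An element `T` of the commutant is determined by the function `k ↦ tr (𝒲_k T)` on `K`, which is
constant on the orbits of `Aut(K, e)`, and there are at most `n + 1` of these. -/
theorem finrank_commutant_le (hp : Odd p) (hg : 0 < g)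
    {W : autKe g (p ^ n) → (L2 g (p ^ n) ≃ₗᵢ[ℂ] L2 g (p ^ n))} (hW : IsWeilRep W) :
    finrank ℂ (commutant W) ≤ n + 1 := by
  let k₀ : K g (p ^ n) := (0, Pi.single ⟨0, hg⟩ 1)
  have hk₀ : ∃ m, IsUnit (omega k₀ m) := ⟨(Pi.single ⟨0, hg⟩ 1, 0), by simp [k₀, omega]⟩
  -- `φ T` is the tuple of the traces `tr (𝒲_k T)` for the representatives `k = p^j k₀`.
  let φ : commutant W →ₗ[ℂ] (Fin (n + 1) → ℂ) :=
    LinearMap.pi fun j => LinearMap.trace ℂ (L2 g (p ^ n)) ∘ₗ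
      LinearMap.llcomp ℂ _ _ _ (normWeyl ((p : ZMod (p ^ n)) ^ (j : ℕ) • k₀)) ∘ₗ
        (commutant W).subtype
  have hφ : Function.Injective φ := by
    rw [← LinearMap.ker_eq_bot, LinearMap.ker_eq_bot']
    intro T hT
    refine Subtype.ext (eq_zero_of_trace_normWeyl_comp (isUnit_two hp) fun k => ?_)
    obtain ⟨j, a, rfl⟩ := exists_autKe_pow_smul hk₀ k
    rw [trace_normWeyl_autKe_comp hW T.2]
    exact congrFun hT j
  simpa using LinearMap.finrank_le_finrank_of_injective hφ

variable {N : ℕ} [NeZero N] {W : autKe g N → (L2 g N ≃ₗᵢ[ℂ] L2 g N)} {X : Submodule ℂ (L2 g N)}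

theorem IsInvariant.exists_eq (hX : IsInvariant W X) (a : autKe g N) {f : L2 g N} (hf : f ∈ X) :
    ∃ h ∈ X, W a h = f := by
  have h1 : X.map (W a).toLinearEquiv.toLinearMap = X := by
    refine Submodule.eq_of_le_of_finrank_eq ?_ (LinearEquiv.finrank_map_eq _ X)
    rintro _ ⟨h, hh, rfl⟩
    exact hX a h hh
  rw [← h1] at hf
  exact hf

theorem IsInvariant.orthogonal (hX : IsInvariant W X) : IsInvariant W Xᗮ := by
  intro a f hf
  rw [Submodule.mem_orthogonal] at hf ⊢
  intro x hx
  obtain ⟨y, hy, rfl⟩ := hX.exists_eq a hx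
  rw [LinearIsometryEquiv.inner_map_map]
  exact hf y hy

theorem IsInvariant.inf {Y : Submodule ℂ (L2 g N)} (hX : IsInvariant W X) (hY : IsInvariant W Y) :
    IsInvariant W (X ⊓ Y) :=
  fun a f hf => ⟨hX a f hf.1, hY a f hf.2⟩

theorem IsInvariant.starProjection_mem_commutant (hX : IsInvariant W X) :
    X.starProjection.toLinearMap ∈ commutant W := by
  intro a f
  refine Submodule.eq_starProjection_of_mem_of_inner_eq_zero
    (hX a _ (Submodule.starProjection_apply_mem X f)) ?_
  intro w hw
  rw [← map_sub]
  exact (Submodule.mem_orthogonal' _ _).1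
    (hX.orthogonal a _ (Submodule.sub_starProjection_mem_orthogonal f)) w hw

/-- If there are at least as many nonzero, pairwise orthogonal invariant subspaces `Y i` as the
dimension of the commutant, the projections onto them span the commutant. An invariant subspace
then contains or is orthogonal to each `Y i`, its projection acting on `Y i` as a scalar. -/
theorem le_or_le_orthogonal_of_isInvariant {ι : Type*} [Fintype ι]
    (Y : ι → Submodule ℂ (L2 g N)) (hY : ∀ i, IsInvariant W (Y i)) (hY0 : ∀ i, Y i ≠ ⊥)
    (hort : ∀ i j, i ≠ j → Y i ≤ (Y j)ᗮ) (hcard : finrank ℂ (commutant W) ≤ Fintype.card ι)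
    (hX : IsInvariant W X) (i : ι) : Y i ≤ X ∨ Y i ≤ Xᗮ := by
  classical
  let P (i : ι) : commutant W := ⟨_, (hY i).starProjection_mem_commutant⟩
  have hP (c : ι → ℂ) (i : ι) (f : L2 g N) (hf : f ∈ Y i) :
      (∑ j, c j • P j : commutant W).1 f = c i • f := by
    rw [Submodule.coe_sum, LinearMap.sum_apply, Finset.sum_eq_single i]
    · exact congrArg (c i • ·) (Submodule.starProjection_eq_self_iff.2 hf)
    · intro j _ hj
      have : (Y j).starProjection f = 0 :=
        (Submodule.starProjection_apply_eq_zero_iff _).2 (hort i j hj.symm hf)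
      change c j • (Y j).starProjection f = 0
      rw [this, smul_zero]
    · simp
  have hlin : LinearIndependent ℂ P := by
    rw [Fintype.linearIndependent_iff]
    intro c hc i
    obtain ⟨f, hf, hf0⟩ := Submodule.exists_mem_ne_zero_of_ne_bot (hY0 i)
    have h := hP c i f hf
    rw [hc] at h
    exact (smul_eq_zero.1 h.symm).resolve_right hf0
  have hspan : Submodule.span ℂ (Set.range P) = ⊤ :=
    hlin.span_eq_top_of_card_eq_finrank' (le_antisymm hlin.fintype_card_le_finrank hcard)
  obtain ⟨c, hc⟩ := (Submodule.mem_span_range_iff_exists_fun ℂ).1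
    (hspan ▸ Submodule.mem_top : (⟨_, hX.starProjection_mem_commutant⟩ : commutant W) ∈ _)
  have hscalar (f) (hf : f ∈ Y i) : X.starProjection f = c i • f := by
    rw [← hP c i f hf, hc]
    rfl
  by_cases hci : c i = 0
  · refine Or.inr fun f hf => ?_
    rw [← Submodule.starProjection_apply_eq_zero_iff, hscalar f hf, hci, zero_smul]
  · refine Or.inl fun f hf => ?_
    rw [← inv_smul_smul₀ hci f, ← hscalar f hf]
    exact X.smul_mem _ (Submodule.starProjection_apply_mem X f)

end Commutant

end Orbits

/-! ### The spaces `U_{n-2r}^ε` -/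

section Decomposition

variable {g p n : ℕ} [Fact p.Prime]

theorem V_anti (hp : Odd p) {r s : ℕ} (hrs : r ≤ s) (hs : s ≤ n / 2) (ε : ℤˣ) :
    V g p n s ε ≤ V g p n r ε := by
  intro f hf
  rw [mem_V_iff hp hs] at hf
  rw [mem_V_iff hp (hrs.trans hs)]
  refine ⟨fun k hk => hf.1 k ?_, hf.2⟩
  obtain ⟨l, rfl⟩ := mem_powSubgroupK.1 hk
  refine mem_powSubgroupK.2 ⟨(p : ZMod (p ^ n)) ^ (s - r) • l, ?_⟩
  rw [smul_smul, ← pow_add]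
  congr 2
  omega

theorem U_le_V (r : ℕ) (ε : ℤˣ) : U g p n r ε ≤ V g p n r ε := by
  unfold U
  split_ifs
  · exact inf_le_left
  · exact le_rfl

theorem U_of_lt {r : ℕ} (hr : r < n / 2) (ε : ℤˣ) :
    U g p n r ε = V g p n r ε ⊓ (V g p n (r + 1) ε)ᗮ := if_pos hr

theorem U_half (ε : ℤˣ) : U g p n (n / 2) ε = V g p n (n / 2) ε := if_neg (lt_irrefl _)

/-- Even functions are orthogonal to odd functions. -/
theorem V_le_orthogonal_V (r s : ℕ) {ε δ : ℤˣ} (h : ε ≠ δ) :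
    V g p n r ε ≤ (V g p n s δ)ᗮ := by
  intro f hf
  rw [Submodule.mem_orthogonal]
  intro q hq
  have hδ : δ = -ε := by
    rcases Int.units_eq_one_or ε with rfl | rfl <;> rcases Int.units_eq_one_or δ with rfl | rfl <;>
      simp_all
  have hε : ((ε : ℤ) : ℂ) * ((ε : ℤ) : ℂ) = 1 := by
    rcases Int.units_eq_one_or ε with rfl | rfl <;> simp
  have h1 : inner ℂ q f = -inner ℂ q f := by
    simp only [PiLp.inner_apply, RCLike.inner_apply]
    rw [← Finset.sum_neg_distrib]
    refine Fintype.sum_equiv (Equiv.neg _) _ _ fun u => ?_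
    rw [Equiv.neg_apply, hf.2.2 u, hq.2.2 u, hδ, Units.val_neg]
    simp only [Int.cast_neg, map_mul, map_neg, map_intCast]
    linear_combination (-f u * (starRingEnd ℂ) (q u)) * hε
  exact self_eq_neg.1 h1

theorem U_le_orthogonal_U (hp : Odd p) {r s : ℕ} (hr : r ≤ n / 2) (hs : s ≤ n / 2) {ε δ : ℤˣ}
    (h : (r, ε) ≠ (s, δ)) : U g p n r ε ≤ (U g p n s δ)ᗮ := by
  have key {r s : ℕ} (hs : s ≤ n / 2) (hrs : r < s) (ε : ℤˣ) :
      U g p n r ε ≤ (U g p n s ε)ᗮ := by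
    rw [U_of_lt (by omega)]
    exact inf_le_right.trans
      (Submodule.orthogonal_le ((U_le_V s ε).trans (V_anti hp (by omega) hs ε)))
  by_cases hε : ε = δ
  · subst hε
    have hrs : r ≠ s := fun h' => h (by rw [h'])
    rcases hrs.lt_or_gt with h' | h'
    · exact key hs h' ε
    · exact (Submodule.le_orthogonal_iff_le_orthogonal).1 (key hr h' ε)
  · exact (U_le_V r ε).trans ((V_le_orthogonal_V r s hε).trans
      (Submodule.orthogonal_le (U_le_V s δ)))

theorem finrank_U_of_lt (hp : Odd p) {r : ℕ} (hr : r < n / 2) (ε : ℤˣ) :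
    (finrank ℂ (U g p n r ε) : ℚ) =
      ((p : ℚ) ^ (g * (n - 2 * r)) - (p : ℚ) ^ (g * (n - 2 * r - 2))) / 2 := by
  have h1 := two_mul_finrank_V (g := g) hp (show r ≤ n / 2 by omega) ε
  have h2 := two_mul_finrank_V (g := g) hp (show r + 1 ≤ n / 2 by omega) ε
  have h3 := Submodule.finrank_add_inf_finrank_orthogonal
    (V_anti (g := g) hp (Nat.le_add_right r 1) (by omega : r + 1 ≤ n / 2) ε)
  rw [inf_comm, ← U_of_lt hr] at h3
  rw [show n - 2 * (r + 1) = n - 2 * r - 2 by omega] at h2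
  rw [← h3] at h1
  push_cast at h1
  linarith

theorem finrank_U_half (hp : Odd p) (ε : ℤˣ) :
    (finrank ℂ (U g p n (n / 2) ε) : ℚ) =
      (((ε : ℤ) : ℚ) + (p : ℚ) ^ (g * (n - 2 * (n / 2)))) / 2 := by
  have h1 := two_mul_finrank_V (g := g) hp (le_refl (n / 2)) ε
  rw [U_half]
  linarith

theorem U_half_neg_one_eq_bot (hp : Odd p) (hn : Even n) : U g p n (n / 2) (-1) = ⊥ := by
  have h := finrank_U_half (g := g) (n := n) hp (-1)
  rw [show n - 2 * (n / 2) = 0 by obtain ⟨m, rfl⟩ := hn; omega] at h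
  rw [← Submodule.finrank_eq_zero (R := ℂ)]
  simpa using h

theorem U_ne_bot (hp : Odd p) (hg : 0 < g) (i : Index n) : U g p n i.1.1 i.1.2 ≠ ⊥ := by
  obtain ⟨⟨r, ε⟩, hi⟩ := i
  have hp1 : (1 : ℚ) < p := by exact_mod_cast (Fact.out : p.Prime).one_lt
  intro h
  rw [← Submodule.finrank_eq_zero (R := ℂ)] at h
  simp only at h hi
  by_cases hr : (r : ℕ) < n / 2
  · have h1 := finrank_U_of_lt (g := g) hp hr ε
    have h2 : (p : ℚ) ^ (g * (n - 2 * r - 2)) < (p : ℚ) ^ (g * (n - 2 * r)) :=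
      pow_lt_pow_right₀ hp1 (Nat.mul_lt_mul_of_pos_left (by omega) hg)
    rw [h, Nat.cast_zero] at h1
    linarith
  · have hr' : (r : ℕ) = n / 2 := by omega
    rw [hr'] at h
    have h1 := finrank_U_half (g := g) (n := n) hp ε
    rw [h, Nat.cast_zero] at h1
    rcases Int.units_eq_one_or ε with rfl | rfl
    · have : (0 : ℚ) < (p : ℚ) ^ (g * (n - 2 * (n / 2))) := by positivity
      simp at h1
      linarith
    · have hn : ¬ Even n := fun hn => hi ⟨hn, hr', rfl⟩
      have h2 : 1 < (p : ℚ) ^ (g * (n - 2 * (n / 2))) := by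
        refine one_lt_pow₀ hp1 (Nat.mul_pos hg ?_).ne'
        rw [Nat.not_even_iff] at hn
        omega
      simp at h1
      linarith

/-- The spaces `V_{n-2r}^ε` are recovered from the `U_{n-2s}^ε` by downward induction on `r`, since
`V_{n-2r}^ε` is the sum of `V_{n-2r-2}^ε` and its complement `U_{n-2r}^ε`. -/
theorem V_le_iSup_U (hp : Odd p) {r : ℕ} (hr : r ≤ n / 2) (ε : ℤˣ) :
    V g p n r ε ≤ ⨆ i : Index n, U g p n i.1.1 i.1.2 := by
  have hU (s : ℕ) (hs : s ≤ n / 2) : U g p n s ε ≤ ⨆ i : Index n, U g p n i.1.1 i.1.2 := by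
    by_cases h : Even n ∧ s = n / 2 ∧ ε = -1
    · obtain ⟨hn, rfl, rfl⟩ := h
      rw [U_half_neg_one_eq_bot hp hn]
      exact bot_le
    · exact le_iSup (fun i : Index n => U g p n i.1.1 i.1.2) ⟨(⟨s, by omega⟩, ε), h⟩
  induction hr using Nat.decreasingInduction with
  | self =>
    rw [← U_half]
    exact hU _ le_rfl
  | of_succ r hr ih =>
    rw [← Submodule.sup_orthogonal_inf_of_hasOrthogonalProjection
      (V_anti (g := g) hp (Nat.le_add_right r 1) hr ε), inf_comm, ← U_of_lt hr]
    exact sup_le ih (hU r hr.le)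

theorem iSup_U_eq_top (hp : Odd p) : ⨆ i : Index n, U g p n i.1.1 i.1.2 = ⊤ := by
  rw [eq_top_iff]
  have h0 (q : L2 g (p ^ n)) (ε : ℤˣ) (hq : parity q = ((ε : ℤ) : ℂ) • q) : q ∈ V g p n 0 ε := by
    refine (mem_V_iff hp (Nat.zero_le _) ε q).2 ⟨fun k hk => ?_, hq⟩
    obtain ⟨l, rfl⟩ := mem_powSubgroupK.1 hk
    rw [Nat.sub_zero, pow_cast_eq_zero le_rfl, zero_smul, normWeyl_zero (isUnit_two hp)]
    rfl
  intro f _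
  have hf : f = (2 : ℂ)⁻¹ • (f + parity f) + (2 : ℂ)⁻¹ • (f - parity f) := by
    module
  rw [hf]
  refine add_mem (Submodule.smul_mem _ _ (V_le_iSup_U hp (Nat.zero_le _) 1 (h0 _ _ ?_)))
    (Submodule.smul_mem _ _ (V_le_iSup_U hp (Nat.zero_le _) (-1) (h0 _ _ ?_)))
  · simp [add_comm]
  · simp

theorem orthogonalFamily_U (hp : Odd p) :
    OrthogonalFamily ℂ (fun i : Index n => U g p n i.1.1 i.1.2)
      (fun i => (U g p n i.1.1 i.1.2).subtypeₗᵢ) := by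
  refine OrthogonalFamily.of_pairwise fun i j hij => ?_
  refine Submodule.isOrtho_iff_le.2 (U_le_orthogonal_U hp (by omega) (by omega) fun h => hij ?_)
  rw [Prod.mk.injEq] at h
  exact Subtype.ext (Prod.ext (Fin.ext h.1) h.2)

/-! ### Irreducibility -/

theorem isInvariant_U (hp : Odd p) {r : ℕ} (hr : r ≤ n / 2) (ε : ℤˣ)
    {W : autKe g (p ^ n) → (L2 g (p ^ n) ≃ₗᵢ[ℂ] L2 g (p ^ n))} (hW : IsWeilRep W) :
    IsInvariant W (U g p n r ε) := by
  unfold U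
  split_ifs with h
  · exact (isInvariant_V hp hr ε hW).inf (isInvariant_V hp h ε hW).orthogonal
  · exact isInvariant_V hp hr ε hW

/-- There are as many summands as orbits of `Aut(K, e)` on `K`; only this inequality is needed. -/
theorem le_card_index (n : ℕ) : n + 1 ≤ Fintype.card (Index n) := by
  classical
  have h : Fintype.card {i : Fin (n / 2 + 1) × ℤˣ // Even n ∧ (i.1 : ℕ) = n / 2 ∧ i.2 = -1} ≤
      if Even n then 1 else 0 := by
    split_ifs with hn
    · refine Fintype.card_le_one_iff.2 fun i j => Subtype.ext (Prod.ext (Fin.ext ?_) ?_)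
      · rw [i.2.2.1, j.2.2.1]
      · rw [i.2.2.2, j.2.2.2]
    · exact (Fintype.card_eq_zero_iff.2 ⟨fun i => hn i.2.1⟩).le
  have h1 : Fintype.card (Index n) = (n / 2 + 1) * 2 - Fintype.card
      {i : Fin (n / 2 + 1) × ℤˣ // Even n ∧ (i.1 : ℕ) = n / 2 ∧ i.2 = -1} := by
    rw [Fintype.card_subtype_compl, Fintype.card_prod, Fintype.card_fin, Fintype.card_units_int]
  rw [h1]
  split_ifs at h with hn
  · rw [Nat.even_iff] at hn
    omega
  · rw [Nat.not_even_iff] at hn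
    omega

/-- An invariant subspace contains or is orthogonal to each `U_{n-2r}^ε`, as these are as many as
the dimension of the commutant. -/
theorem isIrreducibleSubspace_U_and_exists_eq (hp : Odd p) (hg : 0 < g)
    {W : autKe g (p ^ n) → (L2 g (p ^ n) ≃ₗᵢ[ℂ] L2 g (p ^ n))} (hW : IsWeilRep W) :
    (∀ i : Index n, IsIrreducibleSubspace W (U g p n i.1.1 i.1.2)) ∧
      ∀ X, IsIrreducibleSubspace W X → ∃ i : Index n, X = U g p n i.1.1 i.1.2 := by
  have hinv (i : Index n) : IsInvariant W (U g p n i.1.1 i.1.2) :=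
    isInvariant_U hp (by omega) _ hW
  have key {X : Submodule ℂ (L2 g (p ^ n))} (hX : IsInvariant W X) (i : Index n) :
      U g p n i.1.1 i.1.2 ≤ X ∨ U g p n i.1.1 i.1.2 ≤ Xᗮ :=
    le_or_le_orthogonal_of_isInvariant (fun i : Index n => U g p n i.1.1 i.1.2) hinv
      (U_ne_bot hp hg)
      (fun i j hij => Submodule.isOrtho_iff_le.1 ((orthogonalFamily_U hp).isOrtho hij))
      ((finrank_commutant_le hp hg hW).trans (le_card_index n)) hX i
  refine ⟨fun i => ⟨hinv i, U_ne_bot hp hg i, fun Y hYU hY => ?_⟩, fun X hX => ?_⟩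
  · rcases key hY i with h | h
    · exact Or.inr (le_antisymm hYU h)
    · refine Or.inl (eq_bot_iff.2 ?_)
      rw [← Submodule.inf_orthogonal_eq_bot Y]
      exact le_inf le_rfl (hYU.trans h)
  · by_contra! hne
    have h (i : Index n) : U g p n i.1.1 i.1.2 ≤ Xᗮ := by
      refine (key hX.1 i).resolve_left fun hi => ?_
      rcases hX.2.2 _ hi (hinv i) with h | h
      · exact U_ne_bot hp hg i h
      · exact hne i h.symm
    have htop : Xᗮ = ⊤ := by
      rw [eq_top_iff, ← iSup_U_eq_top hp]
      exact iSup_le h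
    exact hX.2.1 ((Submodule.orthogonal_eq_top_iff X).1 htop)

end Decomposition

end FiniteWeil

end

theorem mainTheorem11 (p n g : ℕ) [Fact p.Prime] (hp : Odd p) (hn : 0 < n) (hg : 0 < g) :
    (∃ W : FiniteWeil.autKe g (p ^ n) →
        (FiniteWeil.L2 g (p ^ n) ≃ₗᵢ[ℂ] FiniteWeil.L2 g (p ^ n)), FiniteWeil.IsWeilRep W) ∧
    -- the orthogonal direct sum decomposition
    OrthogonalFamily ℂ (fun i : FiniteWeil.Index n => FiniteWeil.U g p n i.1.1 i.1.2)
      (fun i => (FiniteWeil.U g p n i.1.1 i.1.2).subtypeₗᵢ) ∧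
    DirectSum.IsInternal (fun i : FiniteWeil.Index n => FiniteWeil.U g p n i.1.1 i.1.2) ∧
    (Even n → FiniteWeil.U g p n (n / 2) (-1) = ⊥) ∧
    -- the summands are exactly the irreducible invariant subspaces
    (∀ W : FiniteWeil.autKe g (p ^ n) →
        (FiniteWeil.L2 g (p ^ n) ≃ₗᵢ[ℂ] FiniteWeil.L2 g (p ^ n)), FiniteWeil.IsWeilRep W →
      (∀ i : FiniteWeil.Index n,
        FiniteWeil.IsIrreducibleSubspace W (FiniteWeil.U g p n i.1.1 i.1.2)) ∧
      ∀ X : Submodule ℂ (FiniteWeil.L2 g (p ^ n)), FiniteWeil.IsIrreducibleSubspace W X →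
        ∃ i : FiniteWeil.Index n, X = FiniteWeil.U g p n i.1.1 i.1.2) ∧
    -- the dimensions
    (∀ r : ℕ, r < n / 2 → ∀ ε : ℤˣ,
      (Module.finrank ℂ (FiniteWeil.U g p n r ε) : ℚ) =
        ((p : ℚ) ^ (g * (n - 2 * r)) - (p : ℚ) ^ (g * (n - 2 * r - 2))) / 2) ∧
    (∀ ε : ℤˣ,
      (Module.finrank ℂ (FiniteWeil.U g p n (n / 2) ε) : ℚ) =
        (((ε : ℤ) : ℚ) + (p : ℚ) ^ (g * (n - 2 * (n / 2)))) / 2) := by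
  refine ⟨FiniteWeil.exists_isWeilRep (FiniteWeil.isUnit_two hp),
    FiniteWeil.orthogonalFamily_U hp, ?_, FiniteWeil.U_half_neg_one_eq_bot hp,
    fun _ hW => FiniteWeil.isIrreducibleSubspace_U_and_exists_eq hp hg hW,
    fun r hr ε => FiniteWeil.finrank_U_of_lt hp hr ε, FiniteWeil.finrank_U_half hp⟩
  rw [(FiniteWeil.orthogonalFamily_U hp).isInternal_iff, FiniteWeil.iSup_U_eq_top hp,
    Submodule.top_orthogonal_eq_bot]
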